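/- \textbf{Protocols.} For $K,d\in\mathbb N$, a $K$-round SecAgg-compatible protocol $\mathcal A$ consists of finite fields $\mathcal O_1,\dots,\mathcal O_K$, encoding schemes $\mathcal E_t:\prod_{j<t}\mathcal O_j\times\mathbb R^d\to\mathcal O_t$ ($1\le t\le K$) and a decoding scheme $\mathcal U:\prod_{t\le K}\mathcal O_t\to\mathbb R^d$. These may be randomized: the encoding schemes may use public coins shared by all clients and the server, and private coins, i.i.d. over the clients; the decoding scheme may use the public coins and private coins of the server; all coins are independent of the data. On a dataset $D=(z_1,\dots,z_n)\in(\mathbb R^d)^n$ the aggregates are defined recursively by $O_t=\sum_{i=1}^n\mathcal E_t\big((O_j)_{j<t},z_i\big)$ (sum in $\mathcal O_t$), the output is $\mathcal A(D)=\mathcal U(O_1,\dots,O_K)$, and the total per-client communication is $\sum_{t=1}^K\log_2|\mathcal O_t|$ bits. For $G>0$ and $M\in[0,1]$ let $\mathcal P_1(d,G,M)$ be the set of probability distributions $\mathcal D$ on $\mathbb R^d$ with $\|z\|\le G$ for almost every $z\sim\mathcal D$ and with mean $\mu(\mathcal D)$ satisfying $\|\mu(\mathcal D)\|\le MG$ (Euclidean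 norms). \textbf{Statement.} For every $C>0$ there is $c>0$, depending only on $C$, such that the following holds for all $K,d,n\in\mathbb N$ with $n\ge1$, all $M\in[0,1]$, $G>0$, $\varepsilon>0$, $\delta\in(0,1)$ and every $K$-round SecAgg-compatible protocol $\mathcal A$. Suppose that for every $\mathcal D\in\mathcal P_1(d,G,M)$, with expectations over $D\sim\mathcal D^n$ and the coins, $$\mathbb E[\mathcal A(D)]=\mu(\mathcal D)\quad\text{and}\quad \mathbb E\,\|\mathcal A(D)-\mu(\mathcal D)\|^2\le C\min\Big(M^2G^2,\ \frac{G^2}{n}+\frac{G^2d\log(1/\delta)}{n^2\varepsilon^2}\Big).$$ Then there is a distribution $\mathcal D\in\mathcal P_1(d,G,M)$ such that on $D\sim\mathcal D^n$, with probability $1$, the total per-client communication of $\mathcal A$ is at least $$c\,\min\Big(d,\ \frac{M^2n^2\varepsilon^2}{\log(1/\delta)},\ M^2nd\Big)\ \text{bits}.$$ -/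

import Mathlib

open MeasureTheory
open scoped ENNReal

/-- A `K`-round SecAgg-compatible protocol for vectors in `ℝ^d`.

`Pub`, `Priv`, `Srv` are the probability spaces of the public coins (shared by all clients and the
server), of the private coins of one client, and of the private coins of the server.
`O t` is the finite field over which secure aggregation operates in round `t`.
The encoding scheme of round `t` maps the aggregates of the earlier rounds and a data vector to a
message in `O t`; the decoding scheme maps the aggregates of all rounds to an estimate. -/
structure SecAggProtocol.{u, v, w} (K d : ℕ) where
  Pub : Type u
  Priv : Type v
  Srv : Type w
  [measPub : MeasurableSpace Pub]
  [measPriv : MeasurableSpace Priv]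
  [measSrv : MeasurableSpace Srv]
  pubLaw : Measure Pub
  privLaw : Measure Priv
  srvLaw : Measure Srv
  [probPub : IsProbabilityMeasure pubLaw]
  [probPriv : IsProbabilityMeasure privLaw]
  [probSrv : IsProbabilityMeasure srvLaw]
  O : Fin K → Type
  [field : ∀ t, Field (O t)]
  [finite : ∀ t, Finite (O t)]
  encode : (t : Fin K) → Pub → Priv → ((j : {j : Fin K // j < t}) → O j.1) →
    EuclideanSpace ℝ (Fin d) → O t
  decode : Pub → Srv → ((t : Fin K) → O t) → EuclideanSpace ℝ (Fin d)
  measurable_encode : ∀ (t : Fin K) (h : (j : {j : Fin K // j < t}) → O j.1) (o : O t),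
    MeasurableSet {p : Pub × Priv × EuclideanSpace ℝ (Fin d) | encode t p.1 p.2.1 h p.2.2 = o}
  measurable_decode : ∀ o : (t : Fin K) → O t,
    Measurable fun p : Pub × Srv => decode p.1 p.2 o

namespace SecAggProtocol

attribute [instance] measPub measPriv measSrv probPub probPriv probSrv field finite

variable {K d : ℕ}

/-- All the coins used by a run with `n` clients. -/
abbrev Coins (A : SecAggProtocol K d) (n : ℕ) := A.Pub × (Fin n → A.Priv) × A.Srv

/-- The public coins, the private coins of the `n` clients and the server's coins are independent,
and the clients' coins are identically distributed. -/
noncomputable def coinLaw (A : SecAggProtocol K d) (n : ℕ) : Measure (A.Coins n) :=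
  A.pubLaw.prod ((Measure.pi fun _ : Fin n => A.privLaw).prod A.srvLaw)

/-- The output `O_t` of secure aggregation in round `t`: the sum, in the finite field, of the
messages of the clients, each encoded from the previous aggregates and the client's own vector. -/
noncomputable def aggregate (A : SecAggProtocol K d) {n : ℕ} (ω : A.Coins n)
    (z : Fin n → EuclideanSpace ℝ (Fin d)) (t : Fin K) : A.O t :=
  ∑ i : Fin n, A.encode t ω.1 (ω.2.1 i) (fun j => aggregate A ω z j.1) (z i)
termination_by t.val
decreasing_by exact j.2

/-- The output of the protocol on the dataset `z` with coins `ω`. -/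
noncomputable def output (A : SecAggProtocol K d) {n : ℕ} (ω : A.Coins n)
    (z : Fin n → EuclideanSpace ℝ (Fin d)) : EuclideanSpace ℝ (Fin d) :=
  A.decode ω.1 ω.2.2 (A.aggregate ω z)

/-- Number of bits `b_t = log₂ |O_t|` of a message in round `t`. -/
noncomputable def roundBits (A : SecAggProtocol K d) (t : Fin K) : ℝ :=
  Real.logb 2 (Nat.card (A.O t))

/-- Total per-client communication, in bits. -/
noncomputable def totalBits (A : SecAggProtocol K d) : ℝ :=
  ∑ t, A.roundBits t

end SecAggProtocol

/-- The population mean. -/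
noncomputable def popMean {d : ℕ} (D : ProbabilityMeasure (EuclideanSpace ℝ (Fin d))) :
    EuclideanSpace ℝ (Fin d) :=
  ∫ z, z ∂(D : Measure (EuclideanSpace ℝ (Fin d)))

/-- The distributions on `ℝ^d` that are supported in the ball of radius `G` and whose mean has norm
at most `M G`. -/
def boundedMeanClass (d : ℕ) (G M : ℝ) : Set (ProbabilityMeasure (EuclideanSpace ℝ (Fin d))) :=
  {D | (∀ᵐ z ∂(D : Measure (EuclideanSpace ℝ (Fin d))), ‖z‖ ≤ G) ∧ ‖popMean D‖ ≤ M * G}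

/-- The law `D^n` of a dataset of `n` i.i.d. vectors. -/
noncomputable def dataLaw {d : ℕ} (D : ProbabilityMeasure (EuclideanSpace ℝ (Fin d))) (n : ℕ) :
    Measure (Fin n → EuclideanSpace ℝ (Fin d)) :=
  Measure.pi fun _ : Fin n => (D : Measure (EuclideanSpace ℝ (Fin d)))

namespace SecAggProtocol

variable {K d : ℕ}

/-- The joint law of coins and dataset, the coins being independent of the data. -/
noncomputable def runLaw (A : SecAggProtocol K d) (n : ℕ)
    (D : ProbabilityMeasure (EuclideanSpace ℝ (Fin d))) :
    Measure (A.Coins n × (Fin n → EuclideanSpace ℝ (Fin d))) :=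
  (A.coinLaw n).prod (dataLaw D n)

/-- With `n` clients, the output is an unbiased estimate of the mean of each distribution in `P`. -/
def IsUnbiasedOn (A : SecAggProtocol K d) (n : ℕ)
    (P : Set (ProbabilityMeasure (EuclideanSpace ℝ (Fin d)))) : Prop :=
  ∀ D ∈ P, Integrable (fun x => A.output x.1 x.2) (A.runLaw n D) ∧
    ∫ x, A.output x.1 x.2 ∂(A.runLaw n D) = popMean D

/-- The mean squared error on `n` i.i.d. samples of `D`, over coins and data. -/
noncomputable def meanSqError (A : SecAggProtocol K d) (n : ℕ)
    (D : ProbabilityMeasure (EuclideanSpace ℝ (Fin d))) : ℝ≥0∞ :=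
  ∫⁻ x, ENNReal.ofReal (‖A.output x.1 x.2 - popMean D‖ ^ 2) ∂(A.runLaw n D)

end SecAggProtocol

/-!
Let all clients hold the same vector `x = (r / √d) u`, with `u` uniform on the hypercube `{±1}^d`
and `r` the largest norm allowed for the mean. The data law is then a point mass, and the server
decodes an estimate `X` with `E X = x` and `E ‖X‖² ≤ (C + 1) r²` from a transcript with
`N = ∏ |O_t|` possible values. For fixed coins `X` takes at most `N` values, so since `u` is
sub-Gaussian a union bound over exponential moments gives `E ⟪X, u⟫ - E ‖X‖² / 2 ≤ log N`.
Optimising over multiples of `X` yields `(E ⟪X, u⟫)² ≤ 2 log N · E ‖X‖²`. By unbiasedness the left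
side is `⟪x, u⟫² = r² d`, whence `d ≤ 2 (C + 1) log N`.
-/

open scoped BigOperators InnerProductSpace

section Expect

variable {ι : Type*} [Fintype ι]

theorem expect_prod_pi {R : Type*} [Semifield R] [CharZero R] [DecidableEq ι] {κ : ι → Type*}
    [∀ i, Fintype (κ i)] (f : ∀ i, κ i → R) :
    𝔼 s : ∀ i, κ i, ∏ i, f i (s i) = ∏ i, 𝔼 k, f i k := by
  simp only [Fintype.expect_eq_sum_div_card, Finset.prod_div_distrib, Fintype.prod_sum,
    Fintype.card_pi, Nat.cast_prod]

theorem expect_nonpos_of_expect_exp_le_one {f : ι → ℝ} (hf : 𝔼 i, Real.exp (f i) ≤ 1) :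
    𝔼 i, f i ≤ 0 := by
  rcases isEmpty_or_nonempty ι
  · simp
  calc 𝔼 i, f i ≤ 𝔼 i, (Real.exp (f i) - 1) :=
        Finset.expect_le_expect fun i _ => by linarith [Real.add_one_le_exp (f i)]
    _ = 𝔼 i, Real.exp (f i) - 1 := by rw [Finset.expect_sub_distrib, Fintype.expect_const]
    _ ≤ 0 := by linarith

theorem expect_le_log_card {T : Type*} [Nonempty ι] [Finite T] {g : T → ι → ℝ}
    (hg : ∀ t, 𝔼 i, Real.exp (g t i) ≤ 1) (f : ι → T) :
    𝔼 i, g (f i) i ≤ Real.log (Nat.card T) := by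
  have := Fintype.ofFinite T
  have : Nonempty T := Nonempty.map f ‹_›
  have hT : (0 : ℝ) < Nat.card T := by exact_mod_cast Nat.card_pos
  have hexp : 𝔼 i, Real.exp (g (f i) i - Real.log (Nat.card T)) ≤ 1 := by
    simp only [Real.exp_sub, Real.exp_log hT]
    rw [← Finset.expect_div, div_le_one hT]
    calc 𝔼 i, Real.exp (g (f i) i) ≤ 𝔼 i, ∑ t, Real.exp (g t i) :=
          Finset.expect_le_expect fun i _ => Finset.single_le_sum (f := fun t => Real.exp (g t i))
            (fun t _ => (Real.exp_pos _).le) (Finset.mem_univ (f i))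
      _ = ∑ t, 𝔼 i, Real.exp (g t i) := Finset.expect_sum_comm ..
      _ ≤ ∑ _t : T, 1 := Finset.sum_le_sum fun t _ => hg t
      _ = Nat.card T := by simp
  have := expect_nonpos_of_expect_exp_le_one hexp
  rw [Finset.expect_sub_distrib, Fintype.expect_const] at this
  linarith

variable {Ω : Type*} [MeasurableSpace Ω] {μ : Measure Ω} {f : ι → Ω → ℝ}

theorem integrable_expect (hf : ∀ i, Integrable (f i) μ) :
    Integrable (fun ω => 𝔼 i, f i ω) μ := by
  simp only [Fintype.expect_eq_sum_div_card]
  exact (integrable_finsetSum _ fun i _ => hf i).div_const _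

theorem integral_expect (hf : ∀ i, Integrable (f i) μ) :
    ∫ ω, 𝔼 i, f i ω ∂μ = 𝔼 i, ∫ ω, f i ω ∂μ := by
  simp only [Fintype.expect_eq_sum_div_card]
  rw [integral_div, integral_finsetSum _ fun i _ => hf i]

end Expect

section Subgaussian

variable {E ι Ω T : Type*} [NormedAddCommGroup E] [InnerProductSpace ℝ E] [Fintype ι]
  [MeasurableSpace Ω] [Finite T] {u : ι → E}

/-- A finite family of vectors is sub-Gaussian if its uniformly random member `X` satisfies
`E exp ⟪w, X⟫ ≤ exp (‖w‖² / 2)` for every `w`. The variance proxy is normalised to one. A decoder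
that sees only a short message about `X` can correlate only weakly with it. -/
def IsSubgaussianFamily (u : ι → E) : Prop :=
  ∀ w, 𝔼 i, Real.exp ⟪w, u i⟫_ℝ ≤ Real.exp (‖w‖ ^ 2 / 2)

theorem IsSubgaussianFamily.expect_inner_sub_le_log_card [Nonempty ι] (hu : IsSubgaussianFamily u)
    (enc : ι → T) (dec : T → E) :
    𝔼 i, (⟪dec (enc i), u i⟫_ℝ - ‖dec (enc i)‖ ^ 2 / 2) ≤ Real.log (Nat.card T) := by
  refine expect_le_log_card (g := fun t i => ⟪dec t, u i⟫_ℝ - ‖dec t‖ ^ 2 / 2) (fun t => ?_) enc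
  simp only [Real.exp_sub]
  rw [← Finset.expect_div]
  exact div_le_one_of_le₀ (hu (dec t)) (Real.exp_pos _).le

variable {μ : Measure Ω}

theorem IsSubgaussianFamily.expect_integral_inner_sub_le_log_card [Nonempty ι]
    [IsProbabilityMeasure μ] (hu : IsSubgaussianFamily u) {enc : ι → Ω → T} {dec : Ω → T → E}
    (hX : ∀ i, MemLp (fun ω => dec ω (enc i ω)) 2 μ) :
    𝔼 i, (∫ ω, ⟪dec ω (enc i ω), u i⟫_ℝ ∂μ - (∫ ω, ‖dec ω (enc i ω)‖ ^ 2 ∂μ) / 2) ≤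
      Real.log (Nat.card T) := by
  have hinner i : Integrable (fun ω => ⟪dec ω (enc i ω), u i⟫_ℝ) μ :=
    ((hX i).integrable one_le_two).inner_const _
  have hsq i : Integrable (fun ω => ‖dec ω (enc i ω)‖ ^ 2 / 2) μ :=
    ((hX i).integrable_norm_pow two_ne_zero).div_const 2
  have hint i : Integrable (fun ω => ⟪dec ω (enc i ω), u i⟫_ℝ - ‖dec ω (enc i ω)‖ ^ 2 / 2) μ :=
    (hinner i).sub (hsq i)
  calc 𝔼 i, (∫ ω, ⟪dec ω (enc i ω), u i⟫_ℝ ∂μ - (∫ ω, ‖dec ω (enc i ω)‖ ^ 2 ∂μ) / 2)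
      = ∫ ω, 𝔼 i, (⟪dec ω (enc i ω), u i⟫_ℝ - ‖dec ω (enc i ω)‖ ^ 2 / 2) ∂μ := by
        rw [integral_expect hint]
        simp only [integral_sub (hinner _) (hsq _), integral_div]
    _ ≤ ∫ _, Real.log (Nat.card T) ∂μ :=
        integral_mono (integrable_expect hint) (integrable_const _) fun ω =>
          hu.expect_inner_sub_le_log_card (enc · ω) (dec ω)
    _ = Real.log (Nat.card T) := by simp

theorem IsSubgaussianFamily.sq_expect_integral_inner_le [Nonempty ι] [IsProbabilityMeasure μ]
    (hu : IsSubgaussianFamily u) {enc : ι → Ω → T} {dec : Ω → T → E}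
    (hX : ∀ i, MemLp (fun ω => dec ω (enc i ω)) 2 μ) :
    (𝔼 i, ∫ ω, ⟪dec ω (enc i ω), u i⟫_ℝ ∂μ) ^ 2 ≤
      2 * Real.log (Nat.card T) * 𝔼 i, ∫ ω, ‖dec ω (enc i ω)‖ ^ 2 ∂μ := by
  set S := 𝔼 i, ∫ ω, ⟪dec ω (enc i ω), u i⟫_ℝ ∂μ
  set Q := 𝔼 i, ∫ ω, ‖dec ω (enc i ω)‖ ^ 2 ∂μ
  -- Rescaling the decoder by `x` makes the linear bound a quadratic inequality in `x`.
  have hquad (x : ℝ) : 0 ≤ Q / 2 * (x * x) + -S * x + Real.log (Nat.card T) := by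
    have h := hu.expect_integral_inner_sub_le_log_card (enc := enc)
      (dec := fun ω t => x • dec ω t) fun i => (hX i).const_smul x
    simp only [real_inner_smul_left, norm_smul, mul_pow, integral_const_mul, Real.norm_eq_abs,
      sq_abs, mul_div_assoc, Finset.expect_sub_distrib, ← Finset.mul_expect,
      ← Finset.expect_div] at h
    linarith
  have := discrim_le_zero hquad
  rw [discrim] at this
  linarith

end Subgaussian

section SignVector

variable {ι : Type*} [Fintype ι]

/-- The vertex of the hypercube `{±1}^ι` with sign pattern `s`. Multiples of these vertices are the
hard inputs for mean estimation. -/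
noncomputable def signVector (s : ι → ℤˣ) : EuclideanSpace ℝ ι :=
  WithLp.toLp 2 fun i => ((s i : ℤ) : ℝ)

theorem norm_signVector_sq (s : ι → ℤˣ) : ‖signVector s‖ ^ 2 = Fintype.card ι := by
  have h (i : ι) : ((s i : ℤ) : ℝ) ^ 2 = 1 := by
    rw [sq]
    exact_mod_cast Int.units_coe_mul_self (s i)
  simp [EuclideanSpace.real_norm_sq_eq, signVector, h]

theorem expect_exp_inner_signVector [DecidableEq ι] (w : EuclideanSpace ℝ ι) :
    𝔼 s, Real.exp ⟪w, signVector s⟫_ℝ = ∏ i, Real.cosh (w i) := by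
  have hsign (x : ℝ) : 𝔼 e : ℤˣ, Real.exp ((e : ℤ) * x) = Real.cosh x := by
    rw [Fintype.expect_eq_sum_div_card]
    simp [Real.cosh_eq]
  simp only [← hsign, ← expect_prod_pi, PiLp.inner_apply, signVector, Real.exp_sum,
    RCLike.inner_apply, conj_trivial]

theorem isSubgaussianFamily_signVector [DecidableEq ι] :
    IsSubgaussianFamily (signVector : (ι → ℤˣ) → EuclideanSpace ℝ ι) := fun w =>
  calc 𝔼 s, Real.exp ⟪w, signVector s⟫_ℝ = ∏ i, Real.cosh (w i) := expect_exp_inner_signVector w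
    _ ≤ ∏ i, Real.exp (w i ^ 2 / 2) := Finset.prod_le_prod (fun i _ => (Real.cosh_pos _).le)
        fun i _ => Real.cosh_le_exp_half_sq _
    _ = Real.exp (‖w‖ ^ 2 / 2) := by
        rw [← Real.exp_sum, ← Finset.sum_div, EuclideanSpace.real_norm_sq_eq]

end SignVector

section SecondMoment

variable {E Ω : Type*} [NormedAddCommGroup E] [MeasurableSpace Ω] {μ : Measure Ω} {X : Ω → E}

theorem memLp_two_of_lintegral_norm_sub_sq_ne_top [IsFiniteMeasure μ]
    (hX : AEStronglyMeasurable X μ) {m : E}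
    (h : ∫⁻ ω, ENNReal.ofReal (‖X ω - m‖ ^ 2) ∂μ ≠ ∞) : MemLp X 2 μ := by
  have hsub : AEStronglyMeasurable (fun ω => X ω - m) μ := hX.sub aestronglyMeasurable_const
  have hcentered : MemLp (fun ω => X ω - m) 2 μ :=
    (memLp_two_iff_integrable_sq_norm hsub).2
      ((lintegral_ofReal_ne_top_iff_integrable (hsub.norm.pow 2)
        (.of_forall fun ω => sq_nonneg _)).1 h)
  refine (hcentered.add (memLp_const m)).congr_norm hX (.of_forall fun ω => ?_)
  simp

theorem integral_norm_sq_eq_integral_norm_sub_sq_add [InnerProductSpace ℝ E] [CompleteSpace E]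
    [IsProbabilityMeasure μ] (hX : MemLp X 2 μ) :
    ∫ ω, ‖X ω‖ ^ 2 ∂μ = ∫ ω, ‖X ω - ∫ ω', X ω' ∂μ‖ ^ 2 ∂μ + ‖∫ ω, X ω ∂μ‖ ^ 2 := by
  set m := ∫ ω, X ω ∂μ with hm
  have hint : Integrable X μ := hX.integrable one_le_two
  have hsq : Integrable (fun ω => ‖X ω‖ ^ 2) μ := hX.integrable_norm_pow two_ne_zero
  have hinner : Integrable (fun ω => 2 * ⟪X ω, m⟫_ℝ) μ := (hint.inner_const m).const_mul 2
  have hmean : ∫ ω, ⟪X ω, m⟫_ℝ ∂μ = ‖m‖ ^ 2 := by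
    simp only [real_inner_comm m]
    rw [integral_inner hint, ← hm, real_inner_self_eq_norm_sq]
  simp only [norm_sub_sq_real]
  rw [integral_add (by exact hsq.sub hinner) (integrable_const _), integral_sub hsq hinner,
    integral_const_mul, hmean]
  simp only [integral_const, probReal_univ, one_smul]
  ring

end SecondMoment

section PointMass

variable {d : ℕ} (v : EuclideanSpace ℝ (Fin d))

theorem popMean_diracProba : popMean (diracProba v) = v :=
  integral_dirac _ _

theorem dataLaw_diracProba (n : ℕ) : dataLaw (diracProba v) n = Measure.dirac fun _ => v := by
  refine Measure.pi_eq fun s hs => ?_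
  classical
  simp [diracProba, Measure.dirac_apply', hs, MeasurableSet.univ_pi hs, Set.indicator_apply,
    Finset.prod_ite_zero]

variable {v}

theorem diracProba_mem_boundedMeanClass {G M : ℝ} (hG : 0 ≤ G) (hM : M ≤ 1) (hv : ‖v‖ ≤ M * G) :
    diracProba v ∈ boundedMeanClass d G M := by
  refine ⟨?_, by rwa [popMean_diracProba]⟩
  have h : ‖v‖ ≤ G := hv.trans (mul_le_of_le_one_left hG hM)
  simpa [diracProba, ae_dirac_eq] using h

end PointMass

namespace SecAggProtocol

variable {K d n : ℕ} {A : SecAggProtocol K d} {v : EuclideanSpace ℝ (Fin d)}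
  {P : Set (ProbabilityMeasure (EuclideanSpace ℝ (Fin d)))}

instance : IsProbabilityMeasure (A.coinLaw n) := by
  unfold coinLaw
  infer_instance

theorem log_card_transcript (A : SecAggProtocol K d) :
    Real.log (Nat.card (∀ t, A.O t)) = A.totalBits * Real.log 2 := by
  have hcard : ∀ t ∈ Finset.univ, (Nat.card (A.O t) : ℝ) ≠ 0 := fun t _ => by
    exact_mod_cast Nat.card_pos.ne'
  have h2 : Real.log 2 ≠ 0 := (Real.log_pos one_lt_two).ne'
  rw [Nat.card_pi, Nat.cast_prod, Real.log_prod hcard, totalBits, Finset.sum_mul]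
  exact Finset.sum_congr rfl fun t _ => (div_mul_cancel₀ _ h2).symm

theorem totalBits_nonneg (A : SecAggProtocol K d) : 0 ≤ A.totalBits :=
  Finset.sum_nonneg fun _ _ => Real.logb_nonneg one_lt_two (by exact_mod_cast Nat.card_pos)

theorem runLaw_diracProba (A : SecAggProtocol K d) (n : ℕ) (v : EuclideanSpace ℝ (Fin d)) :
    A.runLaw n (diracProba v) = (A.coinLaw n).map fun ω => (ω, fun _ => v) := by
  rw [runLaw, dataLaw_diracProba, Measure.prod_dirac]

theorem IsUnbiasedOn.integrable_output_const (hA : A.IsUnbiasedOn n P) (hv : diracProba v ∈ P) :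
    Integrable (fun ω => A.output ω fun _ => v) (A.coinLaw n) := by
  have hint := (hA _ hv).1
  rw [runLaw_diracProba] at hint
  exact hint.comp_measurable (by fun_prop)

theorem IsUnbiasedOn.integral_output_const (hA : A.IsUnbiasedOn n P) (hv : diracProba v ∈ P) :
    ∫ ω, A.output ω (fun _ => v) ∂A.coinLaw n = v := by
  obtain ⟨hint, hmean⟩ := hA _ hv
  rw [runLaw_diracProba] at hint hmean
  rwa [integral_map (by fun_prop) hint.aestronglyMeasurable, popMean_diracProba] at hmean

theorem IsUnbiasedOn.meanSqError_diracProba (hA : A.IsUnbiasedOn n P) (hv : diracProba v ∈ P) :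
    A.meanSqError n (diracProba v) =
      ∫⁻ ω, ENNReal.ofReal (‖A.output ω (fun _ => v) - v‖ ^ 2) ∂A.coinLaw n := by
  have hint := (hA _ hv).1
  rw [meanSqError, popMean_diracProba]
  rw [runLaw_diracProba] at hint ⊢
  exact lintegral_map' ((hint.aestronglyMeasurable.sub
    aestronglyMeasurable_const).norm.pow 2).aemeasurable.ennreal_ofReal (by fun_prop)

theorem IsUnbiasedOn.memLp_output_const (hA : A.IsUnbiasedOn n P) (hv : diracProba v ∈ P)
    (hE : A.meanSqError n (diracProba v) ≠ ∞) :
    MemLp (fun ω => A.output ω fun _ => v) 2 (A.coinLaw n) :=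
  memLp_two_of_lintegral_norm_sub_sq_ne_top (hA.integrable_output_const hv).aestronglyMeasurable
    (hA.meanSqError_diracProba hv ▸ hE)

theorem IsUnbiasedOn.integral_norm_output_const_sq (hA : A.IsUnbiasedOn n P)
    (hv : diracProba v ∈ P) (hE : A.meanSqError n (diracProba v) ≠ ∞) :
    ∫ ω, ‖A.output ω fun _ => v‖ ^ 2 ∂A.coinLaw n =
      (A.meanSqError n (diracProba v)).toReal + ‖v‖ ^ 2 := by
  have hX := hA.memLp_output_const hv hE
  rw [integral_norm_sq_eq_integral_norm_sub_sq_add hX, hA.integral_output_const hv,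
    hA.meanSqError_diracProba hv, integral_eq_lintegral_of_nonneg_ae
      (.of_forall fun ω => sq_nonneg _)
      (by exact (hX.1.sub aestronglyMeasurable_const).norm.pow 2)]

theorem IsUnbiasedOn.sq_expect_inner_le {ι : Type*} [Fintype ι] [Nonempty ι]
    (hA : A.IsUnbiasedOn n P) {u x : ι → EuclideanSpace ℝ (Fin d)} (hu : IsSubgaussianFamily u)
    (hx : ∀ i, diracProba (x i) ∈ P) {B r : ℝ} (hB : 0 ≤ B)
    (hE : ∀ i, A.meanSqError n (diracProba (x i)) ≤ ENNReal.ofReal B) (hr : ∀ i, ‖x i‖ ≤ r) :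
    (𝔼 i, ⟪x i, u i⟫_ℝ) ^ 2 ≤ 2 * (A.totalBits * Real.log 2) * (B + r ^ 2) := by
  have hE' i : A.meanSqError n (diracProba (x i)) ≠ ∞ :=
    ((hE i).trans_lt ENNReal.ofReal_lt_top).ne
  have hX i := hA.memLp_output_const (hx i) (hE' i)
  have hinner i : ∫ ω, ⟪A.output ω fun _ => x i, u i⟫_ℝ ∂A.coinLaw n = ⟪x i, u i⟫_ℝ := by
    simp only [real_inner_comm (u i)]
    rw [integral_inner (hA.integrable_output_const (hx i)), hA.integral_output_const (hx i)]
  have hsq i : ∫ ω, ‖A.output ω fun _ => x i‖ ^ 2 ∂A.coinLaw n ≤ B + r ^ 2 := by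
    rw [hA.integral_norm_output_const_sq (hx i) (hE' i)]
    gcongr
    exacts [ENNReal.toReal_le_of_le_ofReal hB (hE i), hr i]
  calc (𝔼 i, ⟪x i, u i⟫_ℝ) ^ 2
      = (𝔼 i, ∫ ω, ⟪A.output ω fun _ => x i, u i⟫_ℝ ∂A.coinLaw n) ^ 2 := by simp only [hinner]
    _ ≤ 2 * Real.log (Nat.card (∀ t, A.O t)) *
          𝔼 i, ∫ ω, ‖A.output ω fun _ => x i‖ ^ 2 ∂A.coinLaw n :=
        hu.sq_expect_integral_inner_le (enc := fun i ω => A.aggregate ω fun _ => x i)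
          (dec := fun ω => A.decode ω.1 ω.2.2) hX
    _ ≤ 2 * (A.totalBits * Real.log 2) * (B + r ^ 2) := by
        rw [A.log_card_transcript]
        have := A.totalBits_nonneg
        gcongr
        exact Finset.expect_le Finset.univ_nonempty fun i _ => hsq i

end SecAggProtocol

theorem mainTheorem4_general {K d n : ℕ} {C r : ℝ} (hC : 0 ≤ C) (hr : 0 < r)
    (A : SecAggProtocol K d) {P : Set (ProbabilityMeasure (EuclideanSpace ℝ (Fin d)))}
    (hP : ∀ v, ‖v‖ ≤ r → diracProba v ∈ P) (hA : A.IsUnbiasedOn n P)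
    (hE : ∀ v, ‖v‖ ≤ r → A.meanSqError n (diracProba v) ≤ ENNReal.ofReal (C * r ^ 2)) :
    (2 * (C + 1) * Real.log 2)⁻¹ * d ≤ A.totalBits := by
  -- If `d = 0`, then `r / √d` is `0`, and so is every `x s`.
  let x : (Fin d → ℤˣ) → EuclideanSpace ℝ (Fin d) := fun s => (r / √d) • signVector s
  have hnorm (s : Fin d → ℤˣ) : ‖signVector s‖ = √d := by
    rw [← Real.sqrt_sq (norm_nonneg (signVector s)), norm_signVector_sq, Fintype.card_fin]
  have hx s : ‖x s‖ ≤ r := by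
    rw [norm_smul, hnorm, Real.norm_of_nonneg (by positivity), div_mul_eq_mul_div]
    exact div_le_of_le_mul₀ (by positivity) hr.le le_rfl
  have hinner s : ⟪x s, signVector s⟫_ℝ = r * √d := by
    rw [real_inner_smul_left, real_inner_self_eq_norm_sq, hnorm]
    field_simp
  have hbits : r ^ 2 * d ≤ 2 * (A.totalBits * Real.log 2) * (C * r ^ 2 + r ^ 2) := by
    have h := hA.sq_expect_inner_le isSubgaussianFamily_signVector (fun s => hP _ (hx s))
      (by positivity) (fun s => hE _ (hx s)) hx
    simpa only [hinner, Fintype.expect_const, mul_pow, Real.sq_sqrt (Nat.cast_nonneg d)] using h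
  rw [inv_mul_le_iff₀ (by positivity)]
  refine le_of_mul_le_mul_left (hbits.trans_eq ?_) (pow_pos hr 2)
  ring

theorem mainTheorem4 (C : ℝ) (hC : 0 < C) :
    ∃ c : ℝ, 0 < c ∧
      ∀ (K d n : ℕ) (M G ε δ : ℝ), 1 ≤ n → 0 ≤ M → M ≤ 1 → 0 < G → 0 < ε → 0 < δ → δ < 1 →
      ∀ A : SecAggProtocol K d,
        A.IsUnbiasedOn n (boundedMeanClass d G M) →
        (∀ D ∈ boundedMeanClass d G M,
          A.meanSqError n D ≤ ENNReal.ofReal (C * min (M ^ 2 * G ^ 2)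
            (G ^ 2 / n + G ^ 2 * d * Real.log (1 / δ) / ((n : ℝ) ^ 2 * ε ^ 2)))) →
        ∃ D ∈ boundedMeanClass d G M, ∀ᵐ _z ∂(dataLaw D n),
          c * min (d : ℝ) (min (M ^ 2 * (n : ℝ) ^ 2 * ε ^ 2 / Real.log (1 / δ))
            (M ^ 2 * n * d)) ≤ A.totalBits := by
  refine ⟨(2 * (C + 1) * Real.log 2)⁻¹, by positivity, ?_⟩
  intro K d n M G ε δ _ hM hM1 hG _ _ _ A hA hE
  have hP (v : EuclideanSpace ℝ (Fin d)) (hv : ‖v‖ ≤ M * G) :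
      diracProba v ∈ boundedMeanClass d G M :=
    diracProba_mem_boundedMeanClass hG.le hM1 hv
  -- The communication does not depend on the data, so any member of the class will do.
  refine ⟨diracProba 0, hP 0 (by simpa using by positivity), .of_forall fun _ => ?_⟩
  rcases hM.eq_or_lt with rfl | hM
  · simpa using A.totalBits_nonneg
  have hE' v (hv : ‖v‖ ≤ M * G) :
      A.meanSqError n (diracProba v) ≤ ENNReal.ofReal (C * (M * G) ^ 2) := by
    rw [mul_pow]
    exact (hE _ (hP v hv)).trans (by gcongr; exact min_le_left _ _)
  calc _ ≤ (2 * (C + 1) * Real.log 2)⁻¹ * d := by gcongr; exact min_le_left _ _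
    _ ≤ A.totalBits := mainTheorem4_general hC.le (mul_pos hM hG) A hP hA hE'
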